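/- Let $d$ be a dimension and let $a,\rho,k>0$ be real numbers. Write $x_{(\beta)}=\Gamma(x+\beta)/\Gamma(x)$ for $x>0$, $\beta\ge 0$, and $x_{(n)}=x(x+1)\cdots(x+n-1)$ for $x\ge 0$, $n\in\{0,1,2,\dots\}$ (so $0_{(0)}=1$ and $0_{(n)}=0$ for $n\ge1$). Let $\mu$ be Lebesgue measure on $\mathbb{R}^d$, and let $N$ be a generalized Waring process on $\mathbb{R}^d$ with parameters $a,\rho,k$ and parameter measure $\mu$; that is, $N$ is a point process (a random boundedly finite, integer-valued Borel measure on $\mathbb{R}^d$) such that for every finite family of pairwise disjoint bounded Borel sets $A_1,\dots,A_l$ and all non-negative integers $n_1,\dots,n_l$ $$P\{N(A_i)=n_i;\ i=1,\dots,l\}=\frac{\rho_{(k\sum_{i}\mu(A_i))}\;a_{(\sum_i n_i)}}{(\rho+a)_{(k\sum_i\mu(A_i)+\sum_i n_i)}}\prod_{i=1}^{l}\frac{[k\mu(A_i)]_{(n_i)}}{n_i!}.$$ Then $N$ is stationary: for every $u\in\mathbb{R}^d$ the translated process $S_uN$, given by $(S_uN)(A)=N(A+u)$ for Borel sets $A$,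 has the same law as $N$ on the space of boundedly finite, integer-valued measures on $\mathbb{R}^d$. -/

import Mathlib

open MeasureTheory

noncomputable section

namespace GWP

/-- The ascending factorial `x_(β) = Γ(x + β) / Γ(x)` with a real index `β ≥ 0`, for `x > 0`. -/
def rising (x β : ℝ) : ℝ := Real.Gamma (x + β) / Real.Gamma x

/-- The ascending factorial `x_(n) = x (x + 1) ⋯ (x + n - 1)` with an integer index. It is also
meaningful at `x = 0`, where `0_(0) = 1` and `0_(n) = 0` for `n ≥ 1`. -/
def risingNat (x : ℝ) (n : ℕ) : ℝ := ∏ j ∈ Finset.range n, (x + j)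

/-- The two ascending factorials agree where both are meaningful. -/
theorem rising_natCast {x : ℝ} (hx : 0 < x) (n : ℕ) : rising x n = risingNat x n := by
  have hG : Real.Gamma x ≠ 0 := (Real.Gamma_pos_of_pos hx).ne'
  induction n with
  | zero => simp [rising, risingNat, hG]
  | succ n ih =>
    have hn : x + n ≠ 0 := by positivity
    have h1 : risingNat x (n + 1) = risingNat x n * (x + n) := by
      simp [risingNat, Finset.prod_range_succ]
    have h2 : x + ((n + 1 : ℕ) : ℝ) = (x + n) + 1 := by push_cast; ring
    rw [h1, ← ih, rising, rising, h2, Real.Gamma_add_one hn]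
    ring

/-- The probability function of the multivariate generalized Waring distribution
`MGWD(a; κ₁, …, κ_l; ρ)` at `(n₁, …, n_l)`. -/
def mgwdPMF {l : ℕ} (a : ℝ) (κ : Fin l → ℝ) (ρ : ℝ) (n : Fin l → ℕ) : ℝ :=
  rising ρ (∑ i, κ i) * risingNat a (∑ i, n i) /
      rising (ρ + a) ((∑ i, κ i) + ((∑ i, n i : ℕ) : ℝ)) *
    ∏ i, risingNat (κ i) (n i) / ((n i).factorial : ℝ)

section PointProcess

variable {S : Type*} [MetricSpace S] [MeasurableSpace S]

/-- A Borel measure is boundedly finite if bounded Borel sets have finite measure. -/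
def BoundedlyFinite (ν : Measure S) : Prop :=
  ∀ A : Set S, MeasurableSet A → Bornology.IsBounded A → ν A < ⊤

variable (S) in
/-- The space of boundedly finite, integer-valued measures on `S`. As a subtype of `Measure S` it
carries the σ-algebra generated by the evaluations `ν ↦ ν A` at Borel sets `A`. -/
abbrev CountingMeasure : Type _ :=
  {ν : Measure S // BoundedlyFinite ν ∧
    ∀ A : Set S, MeasurableSet A → Bornology.IsBounded A → ∃ n : ℕ, ν A = n}

/-- `N` is a generalized Waring process with parameters `a`, `ρ`, `k` and parameter
measure `μ`: a point process (a measurable map into the space of boundedly finite, integer-valued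
measures) whose joint laws over finite families of disjoint bounded Borel sets `A₁, …, A_l` are
`MGWD(a; k μ(A₁), …, k μ(A_l); ρ)`. -/
structure IsGeneralizedWaringProcess {Ω : Type*} [MeasurableSpace Ω] (P : Measure Ω)
    (N : Ω → CountingMeasure S) (a ρ k : ℝ) (μ : Measure S) : Prop where
  measurable : Measurable N
  a_pos : 0 < a
  rho_pos : 0 < ρ
  k_pos : 0 < k
  boundedlyFinite : BoundedlyFinite μ
  fidi : ∀ (l : ℕ) (A : Fin l → Set S), (∀ i, MeasurableSet (A i)) →
    (∀ i, Bornology.IsBounded (A i)) → Pairwise (fun i j => Disjoint (A i) (A j)) →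
    ∀ n : Fin l → ℕ,
      P {ω | ∀ i, (N ω).1 (A i) = n i} =
        ENNReal.ofReal (mgwdPMF a (fun i => k * (μ (A i)).toReal) ρ n)

end PointProcess

section Stationarity

variable {d : ℕ}

/-- The translate `S_u ν` of a counting measure on `ℝ^d`: `(S_u ν)(A) = ν(A + u)`. -/
def shift (u : EuclideanSpace ℝ (Fin d)) (ν : CountingMeasure (EuclideanSpace ℝ (Fin d))) :
    CountingMeasure (EuclideanSpace ℝ (Fin d)) :=
  ⟨ν.1.map (fun x => x - u), by
    have hm : Measurable (fun x : EuclideanSpace ℝ (Fin d) => x - u) := by fun_prop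
    have hb : ∀ A : Set (EuclideanSpace ℝ (Fin d)), Bornology.IsBounded A →
        Bornology.IsBounded ((fun x => x - u) ⁻¹' A) := by
      intro A hA
      have h := (LipschitzWith.id.add (LipschitzWith.const u)).isBounded_image hA
      refine h.subset ?_
      intro x hx
      exact ⟨x - u, hx, by simp⟩
    refine ⟨fun A hA hAb => ?_, fun A hA hAb => ?_⟩
    · rw [Measure.map_apply hm hA]
      exact ν.2.1 _ (hm hA) (hb A hAb)
    · rw [Measure.map_apply hm hA]
      exact ν.2.2 _ (hm hA) (hb A hAb)⟩

theorem shift_apply (u : EuclideanSpace ℝ (Fin d))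
    (ν : CountingMeasure (EuclideanSpace ℝ (Fin d)))
    {A : Set (EuclideanSpace ℝ (Fin d))} (hA : MeasurableSet A) :
    (shift u ν).1 A = ν.1 ((fun x => x + u) '' A) := by
  have hm : Measurable (fun x : EuclideanSpace ℝ (Fin d) => x - u) := by fun_prop
  simp only [shift]
  rw [Measure.map_apply hm hA]
  congr 1
  ext x
  simp [sub_eq_add_neg]

theorem measurable_shift (u : EuclideanSpace ℝ (Fin d)) : Measurable (shift u) := by
  have hm : Measurable (fun x : EuclideanSpace ℝ (Fin d) => x - u) := by fun_prop
  exact ((Measure.measurable_map _ hm).comp measurable_subtype_coe).subtype_mk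

/-- A point process on `ℝ^d` is (strictly) stationary if every translate of it has the same law,
on the space of boundedly finite, integer-valued measures, as the process itself. -/
def IsStationary {Ω : Type*} [MeasurableSpace Ω] (P : Measure Ω)
    (N : Ω → CountingMeasure (EuclideanSpace ℝ (Fin d))) : Prop :=
  Measurable N ∧ ∀ u : EuclideanSpace ℝ (Fin d), P.map (fun ω => shift u (N ω)) = P.map N

end Stationarity

end GWP

end

/-!
A translate of a generalized Waring process is a generalized Waring process with the same
parameters, because translation preserves Lebesgue measure, measurability, boundedness and
disjointness (`GWP.IsGeneralizedWaringProcess.shift`). It remains to see that the joint laws over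
finite families of *disjoint* bounded Borel sets determine the law of a point process
(`GWP.ext_of_disjoint_fidi`).

For this, a finite family of bounded Borel sets is cut into its atoms, which are disjoint bounded
Borel sets, and the mass of each set is the sum of the masses of the atoms inside it
(`GWP.measure_eq_sum_venn`). The masses of the atoms are integers, so their joint law is
determined by the probabilities of single points. Hence all finite-dimensional marginals of
`(ν A)`, with `A` ranging over the bounded Borel sets, are determined, and by uniqueness of
projective limits so is the law of the whole family. Finally, the evaluations at bounded sets
generate the σ-algebra on the space of counting measures
(`GWP.comap_boundedEval_eq`), since `ν A` is the supremum of the masses `ν (A ∩ B)` over growing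
balls `B`.
-/

open MeasureTheory

noncomputable section

namespace GWP

/-! ### Atoms of a finite family of sets -/

section Venn

variable {S ι : Type*}

/-- The cell of the Venn diagram of the family `A` labelled by `T`: the points that lie in `A i`
exactly when `i ∈ T`. -/
def vennCell (A : ι → Set S) (T : Finset ι) : Set S := {x | ∀ i, x ∈ A i ↔ i ∈ T}

theorem vennCell_subset (A : ι → Set S) {T : Finset ι} {i : ι} (hi : i ∈ T) :
    vennCell A T ⊆ A i := fun _ hx => (hx i).2 hi

theorem disjoint_vennCell (A : ι → Set S) {T U : Finset ι} (h : T ≠ U) :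
    Disjoint (vennCell A T) (vennCell A U) :=
  Set.disjoint_left.2 fun _ hT hU => h (Finset.ext fun i => (hT i).symm.trans (hU i))

theorem measurableSet_vennCell [MeasurableSpace S] [Finite ι] {A : ι → Set S}
    (hA : ∀ i, MeasurableSet (A i)) (T : Finset ι) : MeasurableSet (vennCell A T) := by
  have : vennCell A T = ⋂ i, {x | x ∈ A i ↔ i ∈ T} := by
    ext x
    simp [vennCell]
  rw [this]
  exact MeasurableSet.iInter fun i => (hA i).iff (MeasurableSet.const _)

theorem measure_eq_sum_venn [MeasurableSpace S] [Fintype ι] [DecidableEq ι] {A : ι → Set S}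
    (hA : ∀ i, MeasurableSet (A i)) (ν : Measure S) (i : ι) :
    ν (A i) = ∑ T : {T : Finset ι // T.Nonempty}, if i ∈ T.1 then ν (vennCell A T.1) else 0 := by
  classical
  have hU : A i = ⋃ T ∈ Finset.univ.filter (fun T : {T : Finset ι // T.Nonempty} => i ∈ T.1),
      vennCell A T.1 := by
    ext x
    simp only [Set.mem_iUnion, Finset.mem_filter, Finset.mem_univ, true_and, exists_prop]
    refine ⟨fun hx => ?_, fun ⟨T, hi, hx⟩ => vennCell_subset A hi hx⟩
    have hi : i ∈ Finset.univ.filter (fun j => x ∈ A j) := by simpa using hx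
    exact ⟨⟨_, i, hi⟩, hi, fun j => by simp⟩
  rw [← Finset.sum_filter]
  conv_lhs => rw [hU]
  exact measure_biUnion_finset
    (fun T _ U _ h => disjoint_vennCell A (Subtype.coe_injective.ne h))
    (fun T _ => measurableSet_vennCell hA T.1)

end Venn

/-! ### Uniqueness in law from finite-dimensional distributions -/

section Uniqueness

variable {S : Type*} [MetricSpace S] [MeasurableSpace S]

variable (S) in
/-- The bounded Borel sets. -/
abbrev BoundedBorel : Type _ := {A : Set S // MeasurableSet A ∧ Bornology.IsBounded A}

/-- A counting measure as the family of its masses on bounded Borel sets. -/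
def boundedEval (ν : CountingMeasure S) (A : BoundedBorel S) : ENNReal := ν.1 A.1

theorem measurable_eval {A : Set S} (hA : MeasurableSet A) :
    Measurable (fun ν : CountingMeasure S => ν.1 A) :=
  (Measure.measurable_coe hA).comp measurable_subtype_coe

theorem measurable_boundedEval : Measurable (boundedEval (S := S)) :=
  measurable_pi_iff.2 fun A => measurable_eval A.2.1

/-- The evaluations at bounded Borel sets already generate the σ-algebra on the space of counting
measures. -/
theorem comap_boundedEval_eq [OpensMeasurableSpace S] [Nonempty S] :
    MeasurableSpace.comap (boundedEval (S := S)) inferInstance =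
      (inferInstance : MeasurableSpace (CountingMeasure S)) := by
  refine le_antisymm measurable_boundedEval.comap_le ?_
  let x : S := Classical.arbitrary S
  have hval : Measurable[MeasurableSpace.comap (boundedEval (S := S)) inferInstance]
      (Subtype.val : CountingMeasure S → Measure S) := by
    let _ : MeasurableSpace (CountingMeasure S) :=
      MeasurableSpace.comap (boundedEval (S := S)) inferInstance
    refine Measure.measurable_of_measurable_coe _ fun A hA => ?_
    have hsup : (fun ν : CountingMeasure S => ν.1 A) =
        fun ν => ⨆ n : ℕ, ν.1 (A ∩ Metric.ball x n) := by
      funext ν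
      rw [← Monotone.measure_iUnion, ← Set.inter_iUnion, Metric.iUnion_ball_nat, Set.inter_univ]
      intro m n hmn
      exact Set.inter_subset_inter_right _ (Metric.ball_subset_ball (Nat.cast_le.2 hmn))
    rw [hsup]
    refine Measurable.iSup fun n => ?_
    let B : BoundedBorel S := ⟨A ∩ Metric.ball x n, hA.inter measurableSet_ball,
      Metric.isBounded_ball.subset Set.inter_subset_right⟩
    exact (measurable_pi_apply B).comp (comap_measurable (boundedEval (S := S)))
  exact hval.comap_le

/-- The masses that a counting measure gives to a finite family of sets, as natural numbers. On
bounded Borel sets the truncation loses nothing, see `natCast_counts`. -/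
def counts {ι : Type*} (A : ι → Set S) (ν : CountingMeasure S) (i : ι) : ℕ :=
  ⌊(ν.1 (A i)).toReal⌋₊

theorem measurable_counts {ι : Type*} {A : ι → Set S} (hA : ∀ i, MeasurableSet (A i)) :
    Measurable (counts A) :=
  measurable_pi_iff.2 fun i => Nat.measurable_floor.comp (measurable_eval (hA i)).ennreal_toReal

theorem natCast_counts {ι : Type*} {A : ι → Set S} (hA : ∀ i, MeasurableSet (A i))
    (hb : ∀ i, Bornology.IsBounded (A i)) (ν : CountingMeasure S) (i : ι) :
    (counts A ν i : ENNReal) = ν.1 (A i) := by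
  obtain ⟨n, hn⟩ := ν.2.2 (A i) (hA i) (hb i)
  simp [counts, hn]

/-- The law of a point process is determined by its joint laws over finite families of disjoint
bounded Borel sets. -/
theorem ext_of_disjoint_fidi [OpensMeasurableSpace S] [Nonempty S]
    {P Q : Measure (CountingMeasure S)} [IsFiniteMeasure P] [IsFiniteMeasure Q]
    (h : ∀ (l : ℕ) (A : Fin l → Set S), (∀ i, MeasurableSet (A i)) →
      (∀ i, Bornology.IsBounded (A i)) → Pairwise (fun i j => Disjoint (A i) (A j)) →
      ∀ n : Fin l → ℕ, P {ν | ∀ i, ν.1 (A i) = n i} = Q {ν | ∀ i, ν.1 (A i) = n i}) :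
    P = Q := by
  have hcounts : ∀ (l : ℕ) (A : Fin l → Set S), (∀ i, MeasurableSet (A i)) →
      (∀ i, Bornology.IsBounded (A i)) → Pairwise (fun i j => Disjoint (A i) (A j)) →
      P.map (counts A) = Q.map (counts A) := by
    intro l A hA hb hd
    refine Measure.ext_of_singleton fun n => ?_
    have hpre : counts A ⁻¹' {n} =
        {ν : CountingMeasure S | ∀ i, ν.1 (A i) = n i} := by
      ext ν
      simp [funext_iff, ← natCast_counts hA hb]
    rw [Measure.map_apply (measurable_counts hA) (measurableSet_singleton n),
      Measure.map_apply (measurable_counts hA) (measurableSet_singleton n), hpre]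
    exact h l A hA hb hd n
  have hmarg : ∀ I : Finset (BoundedBorel S),
      (P.map boundedEval).map I.restrict = (Q.map boundedEval).map I.restrict := by
    classical
    intro I
    let A : I → Set S := fun i => i.1.1
    have hA : ∀ i, MeasurableSet (A i) := fun i => i.1.2.1
    let e := Fintype.equivFin {T : Finset I // T.Nonempty}
    let C : Fin (Fintype.card {T : Finset I // T.Nonempty}) → Set S :=
      fun j => vennCell A (e.symm j).1
    have hC : ∀ j, MeasurableSet (C j) := fun j => measurableSet_vennCell hA _
    -- Cells with a nonempty label are bounded; the cell outside all the sets is left out.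
    have hCb : ∀ j, Bornology.IsBounded (C j) := fun j => by
      obtain ⟨i, hi⟩ := (e.symm j).2
      exact i.1.2.2.subset (vennCell_subset A hi)
    have hCd : Pairwise (fun i j => Disjoint (C i) (C j)) := fun i j hij =>
      disjoint_vennCell A fun hT => hij (e.symm.injective (Subtype.ext hT))
    let g : (Fin (Fintype.card {T : Finset I // T.Nonempty}) → ℕ) → I → ENNReal :=
      fun n i => ∑ T : {T : Finset I // T.Nonempty}, if i ∈ T.1 then (n (e T) : ENNReal) else 0
    have hg : Measurable g := measurable_of_countable g
    have hfac : I.restrict ∘ boundedEval = g ∘ counts C := by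
      funext ν i
      simp only [Function.comp_apply, g, natCast_counts hC hCb]
      refine (measure_eq_sum_venn hA ν.1 i).trans ?_
      simp [C]
    rw [Measure.map_map (Finset.measurable_restrict I) measurable_boundedEval,
      Measure.map_map (Finset.measurable_restrict I) measurable_boundedEval, hfac,
      ← Measure.map_map hg (measurable_counts hC), ← Measure.map_map hg (measurable_counts hC),
      hcounts _ C hC hCb hCd]
  have hmap : P.map boundedEval = Q.map boundedEval := by
    have : ∀ I : Finset (BoundedBorel S),
        IsFiniteMeasure ((Q.map (boundedEval (S := S))).map I.restrict) := fun I => inferInstance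
    exact IsProjectiveLimit.unique
      (P := fun I : Finset (BoundedBorel S) => (Q.map boundedEval).map I.restrict)
      hmarg (fun _ => rfl)
  ext s hs
  obtain ⟨t, ht, rfl⟩ :
      MeasurableSet[MeasurableSpace.comap (boundedEval (S := S)) inferInstance] s := by
    rw [comap_boundedEval_eq]
    exact hs
  rw [← Measure.map_apply measurable_boundedEval ht, hmap,
    Measure.map_apply measurable_boundedEval ht]

/-- The parameters of a generalized Waring process determine its law. -/
theorem IsGeneralizedWaringProcess.map_eq [OpensMeasurableSpace S] [Nonempty S]
    {Ω Ω' : Type*} [MeasurableSpace Ω] [MeasurableSpace Ω'] {P : Measure Ω} {Q : Measure Ω'}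
    [IsFiniteMeasure P] [IsFiniteMeasure Q] {N : Ω → CountingMeasure S}
    {M : Ω' → CountingMeasure S} {a ρ k : ℝ} {μ : Measure S}
    (hN : IsGeneralizedWaringProcess P N a ρ k μ) (hM : IsGeneralizedWaringProcess Q M a ρ k μ) :
    P.map N = Q.map M := by
  refine ext_of_disjoint_fidi fun l A hA hb hd n => ?_
  have hs : MeasurableSet {ν : CountingMeasure S | ∀ i, ν.1 (A i) = n i} := by
    rw [Set.ofPred_forall]
    exact MeasurableSet.iInter fun i => measurable_eval (hA i) (measurableSet_singleton _)
  rw [Measure.map_apply hN.measurable hs, Measure.map_apply hM.measurable hs]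
  exact (hN.fidi l A hA hb hd n).trans (hM.fidi l A hA hb hd n).symm

end Uniqueness

/-! ### Translates of a generalized Waring process -/

theorem IsGeneralizedWaringProcess.shift {d : ℕ} {Ω : Type*} [MeasurableSpace Ω] {P : Measure Ω}
    {N : Ω → CountingMeasure (EuclideanSpace ℝ (Fin d))} {a ρ k : ℝ}
    (hN : IsGeneralizedWaringProcess P N a ρ k volume) (u : EuclideanSpace ℝ (Fin d)) :
    IsGeneralizedWaringProcess P (fun ω => GWP.shift u (N ω)) a ρ k volume where
  measurable := (measurable_shift u).comp hN.measurable
  a_pos := hN.a_pos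
  rho_pos := hN.rho_pos
  k_pos := hN.k_pos
  boundedlyFinite := hN.boundedlyFinite
  fidi l A hA hb hd n := by
    have hvol : ∀ i, volume ((fun x => x + u) '' A i) = volume (A i) := fun i => by
      rw [Set.image_add_right, measure_preimage_add_right]
    have h := hN.fidi l (fun i => (fun x => x + u) '' A i)
      (fun i => (measurableEmbedding_addRight u).measurableSet_image.2 (hA i))
      (fun i => (LipschitzWith.id.add (LipschitzWith.const u)).isBounded_image (hb i))
      (fun i j hij => (Set.disjoint_image_iff (add_left_injective u)).2 (hd hij)) n
    simpa only [hvol, ← shift_apply u _ (hA _)] using h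

end GWP

end

theorem theorem8 {d : ℕ} {Ω : Type*} [MeasurableSpace Ω] (P : Measure Ω) [IsProbabilityMeasure P]
    (N : Ω → GWP.CountingMeasure (EuclideanSpace ℝ (Fin d))) (a ρ k : ℝ)
    (hN : GWP.IsGeneralizedWaringProcess P N a ρ k volume) :
    GWP.IsStationary P N := by
  exact ⟨hN.measurable, fun u => (hN.shift u).map_eq hN⟩
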